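/- All vector spaces are real. A \emph{Fréchet space} is a complete metrizable locally convex space. A seminorm $p$ is \emph{Hilbertian} if $p(\phi)^2=Q(\phi,\phi)$ for a symmetric non-negative bilinear form $Q$, and then $E_p$ denotes the Hilbert space obtained by completing $E/\ker p$. A Hausdorff locally convex space $E$ is \emph{nuclear} if its topology is generated by a family $\Pi$ of Hilbertian seminorms such that for each $p\in\Pi$ there is $q\in\Pi$ with $p\le q$ for which the canonical map $E_q\to E_p$ is Hilbert--Schmidt. A locally convex space $\Psi$, with continuous linear injections $j_n:\Psi_n\to\Psi$ and continuous linear maps $j_{n,n+1}:\Psi_n\to\Psi_{n+1}$ satisfying $j_{n+1}\circ j_{n,n+1}=j_n$ $(n\in\mathbb{N})$, is the \emph{strict inductive limit} of the sequence of locally convex spaces $(\Psi_n)$ if every $j_{n,n+1}$ is a homeomorphism onto its image, $\Psi=\bigcup_n j_n(\Psi_n)$, and the topology of $\Psi$ is the finest locally convex topology making all $j_n$ continuous; we then write $\Psi=\operatorname{ind}_{n}\Psi_n$. Let $(\mathcal{F}_t)_{t\ge 0}$ be a filtration on a measurable space $(\Omega,\mathcal{F})$, and let $b\mathcal{P}$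 be the space of bounded functions $h:\mathbb{R}_+\times\Omega\to\mathbb{R}$ that are measurable for the predictable $\sigma$-algebra. For a locally convex space $\Phi$ with dual $\Phi'$, let $b\mathcal{P}(\Phi)$ be the space of all $H:\mathbb{R}_+\times\Omega\to\Phi$ such that $(t,\omega)\mapsto\langle f,H_t(\omega)\rangle$ belongs to $b\mathcal{P}$ for every $f\in\Phi'$, with the topology generated by the seminorms $H\mapsto\sup_{(t,\omega)}p(H_t(\omega))$, where $p$ ranges over the continuous seminorms on $\Phi$. A continuous linear map $T:\Phi\to\Psi$ induces the continuous linear map $b\mathcal{P}(\Phi)\to b\mathcal{P}(\Psi)$, $H\mapsto (T H_t(\omega))_{t,\omega}$. \textbf{Proposition.} Let $\Phi=\operatorname{ind}_{n}\Phi_n$ be the strict inductive limit of a sequence of nuclear Fréchet spaces $\Phi_n$, with connecting maps $j_{n,n+1}:\Phi_n\to\Phi_{n+1}$ and canonical injections $j_n:\Phi_n\to\Phi$. Then each $b\mathcal{P}(\Phi_n)$ is a Fréchet space, and $$b\mathcal{P}(\Phi)\simeq\operatorname{ind}_{n\in\mathbb{N}}\,b\mathcal{P}(\Phi_n)$$ topologically: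 with the maps induced by $j_{n,n+1}$ and $j_n$, the space $b\mathcal{P}(\Phi)$ is the strict inductive limit of the Fréchet spaces $b\mathcal{P}(\Phi_n)$. -/

import Mathlib

open MeasureTheory Topology
open scoped NNReal

noncomputable section

/-! ### Locally convex spaces -/

/-- A real Fréchet space: a complete metrizable locally convex space. Completeness refers to the
canonical uniform structure of the additive topological group. -/
structure IsFrechetSpace (E : Type*) [AddCommGroup E] [Module ℝ E] [TopologicalSpace E]
    [IsTopologicalAddGroup E] : Prop where
  continuousSMul : ContinuousSMul ℝ E
  locallyConvex : LocallyConvexSpace ℝ E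
  metrizable : TopologicalSpace.MetrizableSpace E
  complete : @CompleteSpace E (IsTopologicalAddGroup.rightUniformSpace E)

/-- `Q` is a (necessarily non-negative) symmetric bilinear form that induces the seminorm `p`. -/
def Seminorm.IsInducedBy {E : Type*} [AddCommGroup E] [Module ℝ E]
    (p : Seminorm ℝ E) (Q : LinearMap.BilinForm ℝ E) : Prop :=
  (∀ x y, Q x y = Q y x) ∧ ∀ x, p x ^ 2 = Q x x

/-- A seminorm is Hilbertian if it is induced by a symmetric non-negative bilinear form. -/
def Seminorm.IsHilbertian {E : Type*} [AddCommGroup E] [Module ℝ E] (p : Seminorm ℝ E) : Prop :=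
  ∃ Q : LinearMap.BilinForm ℝ E, p.IsInducedBy Q

/-- For Hilbertian seminorms `p ≤ q` on `E`, the canonical map `E_q → E_p` between the Hilbert
spaces obtained by completing `E / ker q` and `E / ker p` is Hilbert-Schmidt.
The squared Hilbert-Schmidt norm of an operator is the supremum of `∑ ‖T eᵢ‖²` over the
finite orthonormal families `e`, which may be taken in a dense subspace; here these are the
families in `E` that are orthonormal for the bilinear form of `q`. -/
def Seminorm.HilbertSchmidtInclusion {E : Type*} [AddCommGroup E] [Module ℝ E]
    (p q : Seminorm ℝ E) : Prop :=
  ∃ Q : LinearMap.BilinForm ℝ E, q.IsInducedBy Q ∧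
    ∃ C : ℝ, ∀ (m : ℕ) (e : Fin m → E),
      (∀ i k, Q (e i) (e k) = if i = k then 1 else 0) → ∑ i, p (e i) ^ 2 ≤ C

/-- A nuclear space: a Hausdorff locally convex space whose topology is generated by a family `P`
of Hilbertian seminorms such that each `p ∈ P` admits `q ∈ P` with `p ≤ q` for which the canonical
inclusion `E_q → E_p` is Hilbert-Schmidt. -/
structure IsNuclearSpace (E : Type*) [AddCommGroup E] [Module ℝ E] [TopologicalSpace E] :
    Prop where
  t2 : T2Space E
  exists_family : ∃ P : Set (Seminorm ℝ E),
    WithSeminorms (fun p : P => (p : Seminorm ℝ E)) ∧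
    (∀ p ∈ P, p.IsHilbertian) ∧
    ∀ p ∈ P, ∃ q ∈ P, p ≤ q ∧ p.HilbertSchmidtInclusion q

/-- `F` is the strict inductive limit of the sequence `E 0 → E 1 → E 2 → ⋯` with connecting maps
`ι n` and canonical maps `j n : E n → F`: the connecting maps are topological embeddings, `F` is
(through the injections `j n`) the increasing union of the spaces `E n`, and the topology of `F`
is the finest locally convex vector space topology for which every `j n` is continuous. (In
Mathlib's order on topologies, smaller means finer, so `IsLeast` singles out the finest one.) -/
structure IsStrictInductiveLimit {E : ℕ → Type*} [∀ n, AddCommGroup (E n)]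
    [∀ n, Module ℝ (E n)] [∀ n, TopologicalSpace (E n)]
    {F : Type*} [AddCommGroup F] [Module ℝ F] [tF : TopologicalSpace F]
    (ι : ∀ n, E n →L[ℝ] E (n + 1)) (j : ∀ n, E n →L[ℝ] F) : Prop where
  isEmbedding : ∀ n, IsEmbedding (ι n)
  injective : ∀ n, Function.Injective (j n)
  compat : ∀ n x, j (n + 1) (ι n x) = j n x
  exists_preimage : ∀ y : F, ∃ n, ∃ x : E n, j n x = y
  finest : IsLeast {t : TopologicalSpace F | @IsTopologicalAddGroup F t _ ∧
    @ContinuousSMul ℝ F _ _ t ∧ @LocallyConvexSpace ℝ F _ _ _ _ t ∧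
    ∀ n, Continuous[inferInstance, t] (j n)} tF

/-! ### Bounded predictable processes -/

variable {Ω : Type*} {mΩ : MeasurableSpace Ω}

/-- A real process `h` belongs to `b𝒫`: it is predictable and bounded on `ℝ₊ × Ω`. -/
def IsBddPredictable (𝓕 : Filtration ℝ≥0 mΩ) (h : ℝ≥0 → Ω → ℝ) : Prop :=
  IsStronglyPredictable 𝓕 h ∧ ∃ C : ℝ, ∀ t ω, |h t ω| ≤ C

/-- The `Φ`-valued processes `H` such that `⟨f, H⟩` is a bounded predictable process for each
continuous linear functional `f` on `Φ`, as a linear space. -/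
def bddPredictableSubmodule (𝓕 : Filtration ℝ≥0 mΩ) (Φ : Type*) [AddCommGroup Φ] [Module ℝ Φ]
    [TopologicalSpace Φ] : Submodule ℝ (ℝ≥0 → Ω → Φ) where
  carrier := {H | ∀ f : Φ →L[ℝ] ℝ, IsBddPredictable 𝓕 fun t ω => f (H t ω)}
  add_mem' := by
    intro H G hH hG f
    obtain ⟨h1, C, hC⟩ := hH f
    obtain ⟨h2, D, hD⟩ := hG f
    refine ⟨?_, C + D, fun t ω => ?_⟩
    · have h3 : Function.uncurry (fun t ω => f ((H + G) t ω)) =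
          Function.uncurry (fun t ω => f (H t ω)) + Function.uncurry (fun t ω => f (G t ω)) := by
        ext x
        simp [Function.uncurry]
      unfold IsStronglyPredictable
      rw [h3]
      exact StronglyMeasurable.add h1 h2
    · simp only [Pi.add_apply, map_add]
      exact (abs_add_le _ _).trans (add_le_add (hC t ω) (hD t ω))
  zero_mem' := by
    intro f
    refine ⟨?_, 0, fun t ω => by simp⟩
    have : Function.uncurry (fun (t : ℝ≥0) (ω : Ω) => f ((0 : ℝ≥0 → Ω → Φ) t ω)) =
        fun _ => (0 : ℝ) := by
      ext x
      simp [Function.uncurry]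
    unfold IsStronglyPredictable
    rw [this]
    exact stronglyMeasurable_const
  smul_mem' := by
    intro c H hH f
    obtain ⟨h1, C, hC⟩ := hH f
    refine ⟨?_, |c| * C, fun t ω => ?_⟩
    · have h3 : Function.uncurry (fun t ω => f ((c • H) t ω)) =
          c • Function.uncurry (fun t ω => f (H t ω)) := by
        ext x
        simp [Function.uncurry]
      unfold IsStronglyPredictable
      rw [h3]
      exact StronglyMeasurable.const_smul h1 c
    · simp only [Pi.smul_apply, map_smul, smul_eq_mul, abs_mul]
      exact mul_le_mul_of_nonneg_left (hC t ω) (abs_nonneg c)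

/-- The space `b𝒫(Φ)`. It is a type of its own, since the submodule would inherit the topology of
pointwise convergence. -/
def BddPredictable (𝓕 : Filtration ℝ≥0 mΩ) (Φ : Type*) [AddCommGroup Φ] [Module ℝ Φ]
    [TopologicalSpace Φ] : Type _ :=
  bddPredictableSubmodule 𝓕 Φ

/-- A map whose compositions with all `p`-bounded linear functionals are bounded is
`p`-bounded. -/
theorem Seminorm.bddAbove_of_weaklyBounded {E α : Type*} [AddCommGroup E] [Module ℝ E]
    (p : Seminorm ℝ E) (g : α → E)
    (h : ∀ f : E →ₗ[ℝ] ℝ, (∃ C, ∀ x, |f x| ≤ C * p x) → ∃ C, ∀ a, |f (g a)| ≤ C) :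
    BddAbove (Set.range fun a => p (g a)) := by
  let _ : SeminormedAddCommGroup E := p.toAddGroupSeminorm.toSeminormedAddCommGroup
  have hnorm : ∀ x : E, ‖x‖ = p x := fun _ => rfl
  let _ : NormedSpace ℝ E := ⟨fun c x => by rw [hnorm, hnorm, map_smul_eq_mul]⟩
  obtain ⟨C, hC⟩ := banach_steinhaus
    (g := fun a => NormedSpace.inclusionInDoubleDual ℝ E (g a)) (fun f => by
      obtain ⟨C, hC⟩ := h f.toLinearMap ⟨‖f‖, fun x => f.le_opNorm x⟩
      exact ⟨C, fun a => hC a⟩)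
  refine ⟨C, ?_⟩
  rintro _ ⟨a, rfl⟩
  obtain ⟨f, hf1, hf2⟩ := exists_dual_vector'' ℝ (g a)
  have h1 := (NormedSpace.inclusionInDoubleDual ℝ E (g a)).le_opNorm f
  rw [NormedSpace.dual_def, hf2] at h1
  have h2 : p (g a) ≤ ‖NormedSpace.inclusionInDoubleDual ℝ E (g a)‖ * ‖f‖ := by
    simpa [hnorm, abs_of_nonneg] using h1
  have h3 := hC a
  have h4 : (0 : ℝ) ≤ ‖NormedSpace.inclusionInDoubleDual ℝ E (g a)‖ := by positivity
  nlinarith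

namespace BddPredictable

variable {𝓕 : Filtration ℝ≥0 mΩ} {Φ : Type*} [AddCommGroup Φ] [Module ℝ Φ] [TopologicalSpace Φ]

instance : AddCommGroup (BddPredictable 𝓕 Φ) :=
  inferInstanceAs (AddCommGroup (bddPredictableSubmodule 𝓕 Φ))

instance : Module ℝ (BddPredictable 𝓕 Φ) :=
  inferInstanceAs (Module ℝ (bddPredictableSubmodule 𝓕 Φ))

instance : CoeFun (BddPredictable 𝓕 Φ) (fun _ => ℝ≥0 → Ω → Φ) :=
  ⟨fun H => H.1⟩

theorem bddAbove [IsTopologicalAddGroup Φ] (p : Seminorm ℝ Φ) (hp : Continuous p)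
    (H : BddPredictable 𝓕 Φ) : BddAbove (Set.range fun x : ℝ≥0 × Ω => p (H x.1 x.2)) := by
  refine p.bddAbove_of_weaklyBounded (fun x : ℝ≥0 × Ω => H x.1 x.2) fun f ⟨C, hC⟩ => ?_
  have hf : Continuous f := by
    refine continuous_of_continuousAt_zero f ?_
    rw [ContinuousAt, map_zero]
    refine squeeze_zero_norm (a := fun x => C * p x) hC ?_
    have : Continuous fun x => C * p x := continuous_const.mul hp
    simpa using this.tendsto 0
  obtain ⟨D, hD⟩ := (H.2 ⟨f, hf⟩).2
  exact ⟨D, fun x => hD x.1 x.2⟩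

/-- The seminorm `H ↦ sup_{(t, ω)} p (H_t(ω))`, for a continuous seminorm `p`; the supremum is
finite by `BddPredictable.bddAbove`. -/
def supSeminorm [IsTopologicalAddGroup Φ] (p : {p : Seminorm ℝ Φ // Continuous p}) :
    Seminorm ℝ (BddPredictable 𝓕 Φ) :=
  Seminorm.ofSMulLE (fun H => ⨆ x : ℝ≥0 × Ω, p.1 (H x.1 x.2))
    (by
      have : ∀ x : ℝ≥0 × Ω, p.1 ((0 : BddPredictable 𝓕 Φ) x.1 x.2) = 0 :=
        fun x => map_zero p.1
      simp [this])
    (fun H G => by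
      refine Real.iSup_le (fun x => ?_) (add_nonneg (Real.iSup_nonneg fun x => apply_nonneg _ _)
        (Real.iSup_nonneg fun x => apply_nonneg _ _))
      exact (map_add_le_add p.1 (H x.1 x.2) (G x.1 x.2)).trans
        (add_le_add (le_ciSup (bddAbove p.1 p.2 H) x) (le_ciSup (bddAbove p.1 p.2 G) x)))
    (fun c H => by
      refine Real.iSup_le (fun x => ?_)
        (mul_nonneg (norm_nonneg c) (Real.iSup_nonneg fun x => apply_nonneg _ _))
      refine (map_smul_eq_mul p.1 c (H x.1 x.2)).trans_le ?_
      exact mul_le_mul_of_nonneg_left (le_ciSup (bddAbove p.1 p.2 H) x) (norm_nonneg c))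

/-- The topology of `b𝒫(Φ)`, generated by the seminorms `H ↦ sup_{(t, ω)} p (H_t(ω))`, where `p`
ranges over the continuous seminorms on `Φ`. -/
instance [IsTopologicalAddGroup Φ] : TopologicalSpace (BddPredictable 𝓕 Φ) :=
  (SeminormFamily.moduleFilterBasis (𝕜 := ℝ)
    (fun p : {p : Seminorm ℝ Φ // Continuous p} => supSeminorm (𝓕 := 𝓕) p)).topology

theorem withSeminorms [IsTopologicalAddGroup Φ] :
    WithSeminorms (𝕜 := ℝ)
      (fun p : {p : Seminorm ℝ Φ // Continuous p} => supSeminorm (𝓕 := 𝓕) p) :=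
  ⟨rfl⟩

instance [IsTopologicalAddGroup Φ] : IsTopologicalAddGroup (BddPredictable 𝓕 Φ) :=
  withSeminorms.topologicalAddGroup

/-- The map `b𝒫(Φ) → b𝒫(Ψ)`, `H ↦ (T H_t(ω))_{t, ω}`, induced by a continuous linear map
`T : Φ → Ψ`. -/
def map [IsTopologicalAddGroup Φ] {Ψ : Type*} [AddCommGroup Ψ] [Module ℝ Ψ] [TopologicalSpace Ψ]
    [IsTopologicalAddGroup Ψ] (𝓕 : Filtration ℝ≥0 mΩ) (T : Φ →L[ℝ] Ψ) :
    BddPredictable 𝓕 Φ →L[ℝ] BddPredictable 𝓕 Ψ where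
  toFun H := ⟨fun t ω => T (H t ω), fun f => H.2 (f.comp T)⟩
  map_add' H G := Subtype.ext <| funext fun t => funext fun ω => T.map_add (H t ω) (G t ω)
  map_smul' c H := Subtype.ext <| funext fun t => funext fun ω => T.map_smul c (H t ω)
  cont := by
    let L : BddPredictable 𝓕 Φ →ₗ[ℝ] BddPredictable 𝓕 Ψ :=
      { toFun := fun H => ⟨fun t ω => T (H t ω), fun f => H.2 (f.comp T)⟩
        map_add' := fun H G =>
          Subtype.ext <| funext fun t => funext fun ω => T.map_add (H t ω) (G t ω)
        map_smul' := fun c H =>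
          Subtype.ext <| funext fun t => funext fun ω => T.map_smul c (H t ω) }
    have hL : Continuous L := by
      refine WithSeminorms.continuous_of_isBounded withSeminorms withSeminorms L fun p => ?_
      refine ⟨{⟨p.1.comp T.toLinearMap, p.2.comp T.continuous⟩}, 1, ?_⟩
      rw [one_smul, Finset.sup_singleton]
      exact fun H => le_rfl
    exact hL

end BddPredictable

end

/-!
The substance of the theorem is that every locally convex topology on `b𝒫(Φ)` that makes the maps
`b𝒫(Φ n) → b𝒫(Φ)` continuous is coarser than the given one. So let `r` be a seminorm on `b𝒫(Φ)`
that is bounded on each `b𝒫(Φ n)` by the supremum of a continuous seminorm `p n`. The seminorm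
`q y = inf {∑ n, 2 ^ n * p n (x n) | y = ∑ n, j n (x n)}` is continuous on `Φ`. A process
with finitely many values decomposes, value by value, into processes `H n` with values in the
spaces `Φ n` such that `p n (H n)` is at most about `2 ^ (-n) * sup q (H)`; hence
`r H ≤ 2 * sup q (H)`. This is `BddPredictable.exists_le_two_mul_supSeminorm`.

Nuclearity enters only in the reduction to processes with finitely many values
(`BddPredictable.exists_simple_approx`). Bounded sets in a nuclear space are precompact, in the
precise form that finitely many continuous functionals distinguish their points up to a given error
(`IsNuclearSpace.exists_finset_dual`). Composed with a process, these functionals are predictable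
and bounded, and rounding their values gives a finite predictable partition on whose sets the
process is nearly constant.

That `b𝒫(Φ)` is the union of the images of the `b𝒫(Φ n)` rests on the Dieudonné-Schwartz theorem
(`IsStrictInductiveLimit.exists_forall_mem_range`): the range of a process is bounded, so it lies in
one step `Φ n`, and the resulting `Φ n`-valued process is weakly predictable because functionals
on `Φ n` extend to `Φ` (`IsStrictInductiveLimit.exists_dual_extension`). Both facts come from
extending continuous seminorms from step to step, by an infimal convolution; the steps are closed
in one another because they are complete. Finally `b𝒫` of a Fréchet space is a Fréchet space by the
usual argument for spaces of bounded functions (`BddPredictable.isFrechetSpace`).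
-/

/-! ### Pushing seminorms forward along surjections -/

namespace Seminorm

section Pushforward

variable {S F : Type*} [AddCommGroup S] [Module ℝ S] [AddCommGroup F] [Module ℝ F]

/-- The quotient seminorm `y ↦ inf {P x | σ x = y}` of a seminorm `P` along a linear
surjection `σ`. -/
noncomputable def pushforward (σ : S →ₗ[ℝ] F) (hσ : Function.Surjective σ) (P : Seminorm ℝ S) :
    Seminorm ℝ F :=
  have hbdd : ∀ y, BddBelow (Set.range fun x : {x // σ x = y} => P x) :=
    fun y => ⟨0, by rintro _ ⟨x, rfl⟩; exact apply_nonneg P _⟩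
  have hle : ∀ {x y}, σ x = y → ⨅ x : {x // σ x = y}, P x ≤ P x :=
    fun {x y} h => ciInf_le (hbdd y) ⟨x, h⟩
  have hne : ∀ y, Nonempty {x // σ x = y} := fun y => (hσ y).elim fun x hx => ⟨⟨x, hx⟩⟩
  Seminorm.ofSMulLE (fun y => ⨅ x : {x // σ x = y}, P x)
    (le_antisymm ((hle (map_zero σ)).trans (map_zero P).le)
      (Real.iInf_nonneg fun _ => apply_nonneg P _))
    (fun y z => by
      have := hne y
      have := hne z
      rw [← sub_le_iff_le_add]
      refine le_ciInf fun u => ?_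
      rw [sub_le_comm]
      refine le_ciInf fun v => ?_
      rw [sub_le_iff_le_add']
      exact (hle (by rw [map_add, u.2, v.2])).trans (map_add_le_add P u.1 v.1))
    (fun c y => by
      have := hne y
      rw [Real.mul_iInf_of_nonneg (norm_nonneg c)]
      refine le_ciInf fun u => ?_
      exact (hle (by rw [map_smul, u.2])).trans (map_smul_eq_mul P c u.1).le)

variable {σ : S →ₗ[ℝ] F} {hσ : Function.Surjective σ} {P : Seminorm ℝ S}

theorem pushforward_apply_le (x : S) : pushforward σ hσ P (σ x) ≤ P x :=
  ciInf_le (f := fun u : {u // σ u = σ x} => P u)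
    ⟨0, by rintro _ ⟨x, rfl⟩; exact apply_nonneg P _⟩ ⟨x, rfl⟩

theorem le_pushforward {y : F} {c : ℝ} (h : ∀ x, σ x = y → c ≤ P x) :
    c ≤ pushforward σ hσ P y :=
  have : Nonempty {x // σ x = y} := (hσ y).elim fun x hx => ⟨⟨x, hx⟩⟩
  le_ciInf (f := fun u : {u // σ u = y} => P u) fun u => h u.1 u.2

theorem exists_lt_of_pushforward_lt {y : F} {c : ℝ} (h : pushforward σ hσ P y < c) :
    ∃ x, σ x = y ∧ P x < c := by
  by_contra! H
  exact h.not_ge (le_pushforward H)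

end Pushforward

/-- The seminorm `x ↦ ∑ n, p n (x n)` on a direct sum. -/
noncomputable def directSum {E : ℕ → Type*} [∀ n, AddCommGroup (E n)] [∀ n, Module ℝ (E n)]
    (p : ∀ n, Seminorm ℝ (E n)) : Seminorm ℝ (Π₀ n, E n) := by
  classical
  have hsum : ∀ (x : Π₀ n, E n) (s : Finset ℕ), x.support ⊆ s →
      ∑ n ∈ x.support, p n (x n) = ∑ n ∈ s, p n (x n) := fun x s hs =>
    Finset.sum_subset hs fun n _ hn => by rw [DFinsupp.notMem_support_iff.1 hn, map_zero]
  refine Seminorm.ofSMulLE (fun x => ∑ n ∈ x.support, p n (x n)) (by simp) (fun x y => ?_)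
    (fun c x => ?_)
  · rw [hsum (x + y) (x.support ∪ y.support) DFinsupp.support_add,
      hsum x _ Finset.subset_union_left, hsum y _ Finset.subset_union_right,
      ← Finset.sum_add_distrib]
    exact Finset.sum_le_sum fun n _ => map_add_le_add (p n) (x n) (y n)
  · rw [hsum (c • x) x.support (DFinsupp.support_smul c x), Finset.mul_sum]
    exact Finset.sum_le_sum fun n _ => (map_smul_eq_mul (p n) c (x n)).le

section DirectSum

variable {E : ℕ → Type*} [∀ n, AddCommGroup (E n)] [∀ n, Module ℝ (E n)]
  (p : ∀ n, Seminorm ℝ (E n))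

theorem directSum_single (n : ℕ) (x : E n) : directSum p (DFinsupp.single n x) ≤ p n x := by
  classical
  change ∑ k ∈ (DFinsupp.single n x).support, p k (DFinsupp.single n x k) ≤ p n x
  refine (Finset.sum_le_sum_of_subset_of_nonneg DFinsupp.support_single_subset
    fun _ _ _ => apply_nonneg _ _).trans ?_
  simp

theorem le_directSum (x : Π₀ n, E n) (n : ℕ) : p n (x n) ≤ directSum p x := by
  classical
  change p n (x n) ≤ ∑ k ∈ x.support, p k (x k)
  by_cases hn : n ∈ x.support
  · exact Finset.single_le_sum (f := fun k => p k (x k)) (fun _ _ => apply_nonneg _ _) hn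
  · rw [DFinsupp.notMem_support_iff.1 hn, map_zero]
    exact Finset.sum_nonneg fun _ _ => apply_nonneg _ _

end DirectSum

/-- A continuous seminorm extends along an embedding with closed range, and the extension can be
made arbitrarily large at a given point outside the range. -/
theorem exists_extension_of_isClosed_range {E F : Type*} [AddCommGroup E] [Module ℝ E]
    [TopologicalSpace E] [AddCommGroup F] [Module ℝ F] [TopologicalSpace F]
    [IsTopologicalAddGroup F] [PolynormableSpace ℝ F] (L : E →L[ℝ] F)
    (hL : IsInducing L) (hcl : IsClosed (Set.range L)) (p : Seminorm ℝ E) (hp : Continuous p)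
    (y : F) (C : ℝ≥0) :
    ∃ q : Seminorm ℝ F, Continuous q ∧ q.comp (L : E →ₗ[ℝ] F) = p ∧
      (y ∉ Set.range L → C ≤ q y) := by
  have hF := PolynormableSpace.withSeminorms ℝ F
  obtain ⟨s, hs, hps⟩ := Seminorm.exists_le_comp_of_isInducing hp (f := (L : E →ₗ[ℝ] F)) hL
  obtain ⟨s', hs', hy⟩ : ∃ s' : Seminorm ℝ F, Continuous s' ∧
      (y ∉ Set.range L → ∀ x, C ≤ s' (y - L x)) := by
    by_cases hy : y ∈ Set.range L
    · exact ⟨s, hs, fun h => (h hy).elim⟩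
    obtain ⟨t, r, hr, ht⟩ := (hF.mem_nhds_iff y _).1 (hcl.isOpen_compl.mem_nhds hy)
    refine ⟨(C * ⟨r, hr.le⟩⁻¹ : ℝ≥0) • t.sup _,
      (Seminorm.continuous_finsetSup fun i _ => i.2).const_smul _, fun _ x => ?_⟩
    have h1 : r ≤ (t.sup fun p : {p : Seminorm ℝ F // Continuous p} => p.1) (y - L x) := by
      by_contra! h
      refine ht (?_ : L x ∈ _) ⟨x, rfl⟩
      rwa [Seminorm.mem_ball, map_sub_rev]
    change (C : ℝ) ≤ ((C * ⟨r, hr.le⟩⁻¹ : ℝ≥0) : ℝ) * _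
    calc (C : ℝ) = C * r⁻¹ * r := by field_simp
      _ ≤ _ := by
        push_cast
        exact mul_le_mul_of_nonneg_left h1 (by positivity)
  -- the infimal convolution `y ↦ inf {p x + (s + s') (y - L x)}`
  let σ : E × F →ₗ[ℝ] F := (L : E →ₗ[ℝ] F).coprod LinearMap.id
  have hσ : Function.Surjective σ := fun z => ⟨(0, z), by simp [σ]⟩
  let P : Seminorm ℝ (E × F) :=
    p.comp (LinearMap.fst ℝ E F) + (s + s').comp (LinearMap.snd ℝ E F)
  have hP : ∀ x z, P (x, z) = p x + (s z + s' z) := fun x z => rfl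
  refine ⟨pushforward σ hσ P, ?_, ?_, fun hyL => ?_⟩
  · refine Seminorm.continuous_of_le (q := s + s') (hs.add hs') fun z => ?_
    have := pushforward_apply_le (σ := σ) (hσ := hσ) (P := P) (0, z)
    simpa [σ, hP] using this
  · ext x
    refine le_antisymm ?_ (le_pushforward (hσ := hσ) ?_)
    · have := pushforward_apply_le (σ := σ) (hσ := hσ) (P := P) (x, 0)
      simpa [σ, hP] using this
    · rintro ⟨x', z⟩ h
      have hz : z = L (x - x') := by
        rw [map_sub]
        exact eq_sub_of_add_eq' h
      have h1 : p (x - x') ≤ s z := by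
        rw [hz]
        exact hps (x - x')
      have h2 := map_add_le_add p x' (x - x')
      rw [add_sub_cancel] at h2
      rw [hP]
      linarith [apply_nonneg s' z]
  · refine le_pushforward ?_
    rintro ⟨x, z⟩ h
    have hz : z = y - L x := eq_sub_of_add_eq' h
    have h1 := hy hyL x
    rw [← hz] at h1
    rw [hP]
    linarith [apply_nonneg p x, apply_nonneg s z]

end Seminorm

/-! ### Strict inductive limits -/

namespace IsStrictInductiveLimit

variable {E : ℕ → Type*} [∀ n, AddCommGroup (E n)] [∀ n, Module ℝ (E n)]
  [∀ n, TopologicalSpace (E n)]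
  {F : Type*} [AddCommGroup F] [Module ℝ F] [TopologicalSpace F]
  {ι : ∀ n, E n →L[ℝ] E (n + 1)} {j : ∀ n, E n →L[ℝ] F}

/-- For a family of seminorms compatible with the connecting maps, an element of a step has the same
seminorm in all later steps. With zero seminorms this says that the steps increase. -/
theorem exists_lift_of_le (h : IsStrictInductiveLimit ι j) (p : ∀ n, Seminorm ℝ (E n))
    (hp : ∀ n, (p (n + 1)).comp (ι n : E n →ₗ[ℝ] E (n + 1)) = p n) {n m : ℕ} (hnm : n ≤ m)
    (x : E n) : ∃ x' : E m, j m x' = j n x ∧ p m x' = p n x := by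
  induction m, hnm using Nat.le_induction with
  | base => exact ⟨x, rfl, rfl⟩
  | succ m _ ih =>
    obtain ⟨x', h1, h2⟩ := ih
    exact ⟨ι m x', (h.compat m x').trans h1, by rw [← h2, ← hp m]; rfl⟩

/-- Dropping the first `N` steps does not change the limit. -/
theorem shift (h : IsStrictInductiveLimit ι j) (N : ℕ) :
    IsStrictInductiveLimit (fun n => ι (N + n)) (fun n => j (N + n)) where
  isEmbedding n := h.isEmbedding (N + n)
  injective n := h.injective (N + n)
  compat n := h.compat (N + n)
  exists_preimage y := by
    obtain ⟨n, x, rfl⟩ := h.exists_preimage y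
    obtain ⟨x', hx', -⟩ := h.exists_lift_of_le (fun _ => 0) (fun _ => rfl) (Nat.le_add_left n N) x
    exact ⟨n, x', hx'⟩
  finest := by
    refine ⟨⟨h.finest.1.1, h.finest.1.2.1, h.finest.1.2.2.1, fun n => (j (N + n)).continuous⟩, ?_⟩
    have hleast := h.finest.2
    have hj : ∀ n, (j n : E n → F) = j (n + 1) ∘ ι n := fun n =>
      funext fun x => (h.compat n x).symm
    rintro t ⟨h1, h2, h3, h4⟩
    refine hleast ⟨h1, h2, h3, fun n => ?_⟩
    obtain hn | hn := le_total N n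
    · obtain ⟨k, rfl⟩ := Nat.exists_eq_add_of_le hn
      exact h4 k
    · induction hn using Nat.decreasingInduction with
      | self => exact h4 0
      | of_succ k _ ih =>
        rw [hj k]
        exact ih.comp (ι k).continuous

variable [∀ n, IsTopologicalAddGroup (E n)]

theorem continuous_seminorm (h : IsStrictInductiveLimit ι j) (q : Seminorm ℝ F)
    (hq : ∀ n, Continuous (q.comp (j n : E n →ₗ[ℝ] F))) : Continuous q := by
  let J : ∀ n, E n →ₗ[ℝ] F := fun n => (j n : E n →ₗ[ℝ] F)
  have hleast := h.finest.2
  let t : TopologicalSpace F :=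
    (SeminormFamily.moduleFilterBasis (𝕜 := ℝ) (fun _ : Unit => q)).topology
  have ht : WithSeminorms (topology := t) (fun _ : Unit => q) := ⟨rfl⟩
  have hJ : ∀ n, Continuous[_, t] (J n) := fun n =>
    ht.continuous_of_continuous_comp (J n) fun _ => hq n
  have hle := hleast ⟨ht.topologicalAddGroup, ht.continuousSMul, ht.toLocallyConvexSpace, hJ⟩
  exact continuous_le_dom hle (ht.continuous_seminorm ())

/-- Compatible continuous seminorms on the steps are the restrictions of a continuous seminorm on
the limit. -/
theorem exists_seminorm_eq (h : IsStrictInductiveLimit ι j) (p : ∀ n, Seminorm ℝ (E n))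
    (hpc : ∀ n, Continuous (p n))
    (hp : ∀ n, (p (n + 1)).comp (ι n : E n →ₗ[ℝ] E (n + 1)) = p n) :
    ∃ q : Seminorm ℝ F, Continuous q ∧ ∀ n x, q (j n x) = p n x := by
  choose N u hu using h.exists_preimage
  have key : ∀ n x, p (N (j n x)) (u (j n x)) = p n x := fun n x => by
    obtain ⟨x₁, h1, h1'⟩ := h.exists_lift_of_le p hp (le_max_left n (N (j n x))) x
    obtain ⟨x₂, h2, h2'⟩ := h.exists_lift_of_le p hp (le_max_right n (N (j n x))) (u (j n x))
    have : x₁ = x₂ := h.injective _ (by rw [h1, h2, hu])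
    rw [← h1', ← h2', this]
  let q : Seminorm ℝ F := Seminorm.of (fun y => p (N y) (u y))
    (fun y z => by
      obtain ⟨x₁, h1, h1'⟩ := h.exists_lift_of_le p hp (le_max_left (N y) (N z)) (u y)
      obtain ⟨x₂, h2, h2'⟩ := h.exists_lift_of_le p hp (le_max_right (N y) (N z)) (u z)
      have h3 : y + z = j _ (x₁ + x₂) := by rw [map_add, h1, h2, hu, hu]
      rw [h3, key, ← h1', ← h2']
      exact map_add_le_add _ _ _)
    (fun c y => by
      have h3 : c • y = j _ (c • u y) := by rw [map_smul, hu]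
      rw [h3, key]
      exact map_smul_eq_mul _ _ _)
  have hq : ∀ n x, q (j n x) = p n x := key
  refine ⟨q, h.continuous_seminorm q fun n => ?_, hq⟩
  have : (q.comp (j n : E n →ₗ[ℝ] F)) = p n := by
    ext x
    exact hq n x
  rw [this]
  exact hpc n

/-- A continuous seminorm on step `0` extends to the limit, and the extension can be made
arbitrarily large at one new point in each later step. -/
theorem exists_seminorm_extension_zero [∀ n, PolynormableSpace ℝ (E n)]
    (h : IsStrictInductiveLimit ι j) (hcl : ∀ n, IsClosed (Set.range (ι n)))
    (p : Seminorm ℝ (E 0)) (hp : Continuous p) (y : ∀ n, E (n + 1)) (C : ℕ → ℝ≥0) :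
    ∃ q : Seminorm ℝ F, Continuous q ∧ (∀ x, q (j 0 x) = p x) ∧
      ∀ n, y n ∉ Set.range (ι n) → C n ≤ q (j (n + 1) (y n)) := by
  choose f hf1 hf2 hf3 using fun n (p : Seminorm ℝ (E n)) (hp : Continuous p) =>
    p.exists_extension_of_isClosed_range (ι n) (h.isEmbedding n).isInducing (hcl n) hp (y n) (C n)
  let P : ∀ n, {p : Seminorm ℝ (E n) // Continuous p} := fun n =>
    Nat.rec ⟨p, hp⟩ (fun n r => ⟨f n r.1 r.2, hf1 n r.1 r.2⟩) n
  obtain ⟨q, hq, hqP⟩ := h.exists_seminorm_eq (fun n => (P n).1) (fun n => (P n).2)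
    fun n => hf2 n (P n).1 (P n).2
  refine ⟨q, hq, hqP 0, fun n hn => ?_⟩
  rw [hqP]
  exact hf3 n (P n).1 (P n).2 hn

/-- Every continuous seminorm on a step extends to the limit. -/
theorem exists_seminorm_extension [∀ n, PolynormableSpace ℝ (E n)]
    (h : IsStrictInductiveLimit ι j) (hcl : ∀ n, IsClosed (Set.range (ι n))) (N : ℕ)
    (p : Seminorm ℝ (E N)) (hp : Continuous p) :
    ∃ q : Seminorm ℝ F, Continuous q ∧ ∀ x, q (j N x) = p x := by
  obtain ⟨q, hq, hqp, -⟩ := (h.shift N).exists_seminorm_extension_zero (fun n => hcl (N + n)) p hp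
    (fun _ => 0) 0
  exact ⟨q, hq, hqp⟩

/-- **Hahn-Banach theorem** for the steps of a strict inductive limit. -/
theorem exists_dual_extension [∀ n, PolynormableSpace ℝ (E n)] [IsTopologicalAddGroup F]
    (h : IsStrictInductiveLimit ι j) (hcl : ∀ n, IsClosed (Set.range (ι n))) (n : ℕ)
    (f : E n →L[ℝ] ℝ) : ∃ g : F →L[ℝ] ℝ, ∀ x, g (j n x) = f x := by
  have := h.finest.1.2.1
  have := h.finest.1.2.2.1
  obtain ⟨q, hq, hqf⟩ := h.exists_seminorm_extension hcl n ((normSeminorm ℝ ℝ).comp f.toLinearMap)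
    f.continuous.norm
  let e := LinearEquiv.ofInjective (j n).toLinearMap (h.injective n)
  obtain ⟨g, hg, -⟩ := Module.Dual.exists_continuous_extension_of_le_seminorm_real
    (LinearMap.range (j n).toLinearMap) (f.toLinearMap ∘ₗ e.symm.toLinearMap) hq (fun x => by
      obtain ⟨x, rfl⟩ := e.surjective x
      change f (e.symm (e x)) ≤ q (j n x)
      rw [hqf, e.symm_apply_apply]
      exact le_abs_self _)
  refine ⟨g, fun x => ?_⟩
  have := hg (e x)
  change g (j n x) = f (e.symm (e x)) at this
  rwa [e.symm_apply_apply] at this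

/-- The **Dieudonné-Schwartz theorem**: a bounded family in a strict inductive limit lies in one of
the steps. Otherwise there are infinitely many steps at which a member of the family appears for the
first time, and a continuous seminorm can be made large at these members one after the other. -/
theorem exists_forall_mem_range [∀ n, PolynormableSpace ℝ (E n)]
    (h : IsStrictInductiveLimit ι j) (hcl : ∀ n, IsClosed (Set.range (ι n)))
    {X : Type*} (g : X → F)
    (hg : ∀ q : Seminorm ℝ F, Continuous q → BddAbove (Set.range fun x => q (g x))) :
    ∃ n, ∀ x, g x ∈ Set.range (j n) := by
  classical
  by_contra! H
  let A : ∀ n, Set (E (n + 1)) := fun n => {y | y ∉ Set.range (ι n) ∧ ∃ x, j (n + 1) y = g x}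
  let y : ∀ n, E (n + 1) := fun n => if hn : (A n).Nonempty then hn.some else 0
  obtain ⟨q, hq, -, hqy⟩ := h.exists_seminorm_extension_zero hcl 0 continuous_const y (fun n => n)
  obtain ⟨M, hM⟩ := hg q hq
  obtain ⟨n, hn⟩ := exists_nat_gt M
  obtain ⟨x, hx⟩ := H n
  have hex : ∃ m, g x ∈ Set.range (j m) := h.exists_preimage (g x)
  have hmono : ∀ {k m}, k ≤ m → g x ∈ Set.range (j k) → g x ∈ Set.range (j m) := by
    rintro k m hkm ⟨z, hz⟩
    obtain ⟨z', hz', -⟩ := h.exists_lift_of_le (fun _ => 0) (fun _ => rfl) hkm z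
    exact ⟨z', hz'.trans hz⟩
  -- `m + 1` is the first step that contains `g x`
  obtain ⟨m, hm⟩ : ∃ m, Nat.find hex = m + 1 := by
    refine Nat.exists_eq_succ_of_ne_zero fun h0 => hx ?_
    exact hmono (Nat.zero_le n) (h0 ▸ Nat.find_spec hex)
  have hm1 : g x ∈ Set.range (j (m + 1)) := hm ▸ Nat.find_spec hex
  have hm2 : g x ∉ Set.range (j m) := Nat.find_min hex (by omega)
  have hnm : n ≤ m := by
    by_contra! hlt
    exact hx (hmono hlt hm1)
  obtain ⟨z, hz⟩ := hm1
  have hA : (A m).Nonempty := by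
    refine ⟨z, ?_, x, hz⟩
    rintro ⟨w, rfl⟩
    exact hm2 ⟨w, by rw [← hz, h.compat]⟩
  have hym : y m ∈ A m := by
    simp only [y, dif_pos hA]
    exact hA.some_mem
  obtain ⟨hy1, x', hx'⟩ := hym
  have h1 := hqy m hy1
  rw [hx'] at h1
  have h2 : q (g x') ≤ M := hM ⟨x', rfl⟩
  have h3 : (n : ℝ) ≤ m := by exact_mod_cast hnm
  simp at h1
  linarith

end IsStrictInductiveLimit

/-! ### Precompactness in nuclear spaces -/

/-- A Hilbert-Schmidt inclusion is, up to a small multiple of the larger seminorm, controlled by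
finitely many functionals. They are the coordinates with respect to a finite orthonormal family
for which `∑ p (e i) ^ 2` is nearly maximal: a unit vector orthogonal to such a family has small
`p`, since otherwise it could be added to the family. -/
theorem Seminorm.HilbertSchmidtInclusion.exists_le_sum_add {E : Type*} [AddCommGroup E]
    [Module ℝ E] {p q : Seminorm ℝ E} (h : p.HilbertSchmidtInclusion q) (hpq : p ≤ q) {ε : ℝ}
    (hε : 0 < ε) :
    ∃ (m : ℕ) (f : Fin m → E →ₗ[ℝ] ℝ) (a : Fin m → ℝ), (∀ k x, |f k x| ≤ q x) ∧ (∀ k, 0 ≤ a k) ∧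
      ∀ x, p x ≤ ∑ k, |f k x| * a k + ε * q x := by
  obtain ⟨Q, ⟨hsymm, hQ⟩, C, hC⟩ := h
  let A : Set ℝ := {s | ∃ (m : ℕ) (e : Fin m → E),
    (∀ i k, Q (e i) (e k) = if i = k then 1 else 0) ∧ s = ∑ i, p (e i) ^ 2}
  have hA : BddAbove A := ⟨C, by rintro _ ⟨m, e, he, rfl⟩; exact hC m e he⟩
  have hA0 : A.Nonempty := ⟨_, 0, Fin.elim0, fun i => i.elim0, rfl⟩
  obtain ⟨_, ⟨m, e, he, rfl⟩, hs⟩ :=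
    exists_lt_of_lt_csSup hA0 (sub_lt_self (sSup A) (sq_pos_of_pos hε))
  refine ⟨m, fun k => Q.flip (e k), fun k => p (e k), fun k x => ?_, fun k => apply_nonneg _ _,
    fun x => ?_⟩
  · change |Q x (e k)| ≤ q x
    refine abs_le_of_sq_le_sq ?_ (apply_nonneg q x)
    have h1 : 0 ≤ Q (x - Q x (e k) • e k) (x - Q x (e k) • e k) := by
      rw [← hQ]
      positivity
    have h2 : Q (e k) (e k) = 1 := by simp [he]
    simp only [map_sub, map_smul, LinearMap.sub_apply, LinearMap.smul_apply, smul_eq_mul,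
      hsymm (e k) x, h2] at h1
    rw [hQ]
    nlinarith
  · change p x ≤ ∑ k, |Q x (e k)| * p (e k) + ε * q x
    set w : E := ∑ k, Q x (e k) • e k with hw
    have horth : ∀ k, Q (x - w) (e k) = 0 := fun k => by
      simp [hw, he, LinearMap.sub_apply, LinearMap.sum_apply]
    have hpw : p w ≤ ∑ k, |Q x (e k)| * p (e k) := by
      refine (Finset.le_sum_of_subadditive p (map_zero p).le (map_add_le_add p) _ _).trans
        (Finset.sum_le_sum fun k _ => ?_)
      exact (map_smul_eq_mul p _ _).le
    -- `x - w` is the orthogonal projection of `x` for the form `Q`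
    have hqw : q (x - w) ≤ q x := by
      refine abs_le_of_sq_le_sq' ?_ (apply_nonneg q x) |>.2
      have h1 : Q (x - w) w = 0 := by
        rw [hw, map_sum]
        exact Finset.sum_eq_zero fun k _ => by rw [map_smul, ← hw, horth, smul_zero]
      have h2 : 0 ≤ Q w w := by
        rw [← hQ]
        positivity
      have h3 := hsymm (x - w) w
      have h4 : Q x x = Q (x - w) (x - w) + Q (x - w) w + Q w (x - w) + Q w w := by
        simp only [map_sub, LinearMap.sub_apply]
        ring
      rw [hQ, hQ, h4]
      linarith
    have hpx : p (x - w) ≤ ε * q (x - w) := by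
      obtain h0 | h0 := (apply_nonneg q (x - w)).eq_or_lt
      · rw [← h0, mul_zero, h0]
        exact hpq _
      have h1 : ∑ i : Fin (m + 1), p (Fin.cons (α := fun _ => E) ((q (x - w))⁻¹ • (x - w)) e i) ^ 2
          ≤ sSup A := by
        refine le_csSup hA ⟨m + 1, _, fun i k => ?_, rfl⟩
        refine Fin.cases ?_ (fun i => ?_) i <;> refine Fin.cases ?_ (fun k => ?_) k
        · simp only [Fin.cons_zero, map_smul, LinearMap.smul_apply, smul_eq_mul, ← hQ, if_true]
          field_simp
        · simp [horth, -map_sub, (Fin.succ_ne_zero k).symm]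
        · simp [horth, -map_sub, hsymm (e i) (x - w)]
        · simp [he]
      rw [Fin.sum_univ_succ] at h1
      simp only [Fin.cons_zero, Fin.cons_succ] at h1
      have h2 : p ((q (x - w))⁻¹ • (x - w)) ≤ ε :=
        (abs_le_of_sq_le_sq' (by linarith) hε.le).2
      rw [map_smul_eq_mul, Real.norm_eq_abs, abs_of_pos (inv_pos.2 h0), inv_mul_le_iff₀ h0] at h2
      linarith
    calc p x = p (w + (x - w)) := by rw [add_sub_cancel]
      _ ≤ p w + p (x - w) := map_add_le_add p _ _
      _ ≤ _ := add_le_add hpw (hpx.trans (mul_le_mul_of_nonneg_left hqw hε.le))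

/-- Bounded families in a nuclear space are precompact: up to a given error in a continuous
seminorm, their members are distinguished by finitely many continuous functionals. -/
theorem IsNuclearSpace.exists_finset_dual {E : Type*} [AddCommGroup E] [Module ℝ E]
    [TopologicalSpace E] (hE : IsNuclearSpace E) {X : Type*} (g : X → E)
    (hg : ∀ q : Seminorm ℝ E, Continuous q → BddAbove (Set.range fun x => q (g x)))
    (p : Seminorm ℝ E) (hp : Continuous p) {δ : ℝ} (hδ : 0 < δ) :
    ∃ (s : Finset (E →L[ℝ] ℝ)) (η : ℝ), 0 < η ∧
      ∀ x y, (∀ f ∈ s, |f (g x) - f (g y)| ≤ η) → p (g x - g y) ≤ δ := by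
  classical
  obtain ⟨P, hP, -, hPq⟩ := hE.exists_family
  have := hP.topologicalAddGroup
  have base : ∀ i : P, ∀ δ : ℝ, 0 < δ → ∃ (s : Finset (E →L[ℝ] ℝ)) (η : ℝ), 0 < η ∧
      ∀ x y, (∀ f ∈ s, |f (g x) - f (g y)| ≤ η) → (i : Seminorm ℝ E) (g x - g y) ≤ δ := by
    rintro ⟨i, hi⟩ δ hδ
    obtain ⟨q, hq, hiq, hHS⟩ := hPq i hi
    have hqc : Continuous q := hP.continuous_seminorm ⟨q, hq⟩
    obtain ⟨M, hM⟩ := hg q hqc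
    have hM' : ∀ x, q (g x) ≤ |M| + 1 := fun x =>
      (hM ⟨x, rfl⟩).trans ((le_abs_self M).trans (by linarith))
    have hM0 : 0 < |M| + 1 := by positivity
    -- differences of members have `q` at most `2 * (|M| + 1)`, so this `ε` contributes `δ / 2`
    obtain ⟨m, f, a, hf, ha, hle⟩ :=
      hHS.exists_le_sum_add hiq (ε := δ / (4 * (|M| + 1))) (by positivity)
    have hfc : ∀ k, Continuous (f k) := fun k => by
      have : Continuous ((normSeminorm ℝ ℝ).comp (f k)) := Seminorm.continuous_of_le hqc (hf k)
      exact (norm_withSeminorms ℝ ℝ).continuous_of_continuous_comp (f k) fun _ => this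
    have ha0 : 0 ≤ ∑ k, a k := Finset.sum_nonneg fun k _ => ha k
    refine ⟨Finset.univ.image fun k => (⟨f k, hfc k⟩ : E →L[ℝ] ℝ), δ / (2 * (∑ k, a k + 1)),
      by positivity, fun x y hxy => (hle _).trans ?_⟩
    have h1 : ∑ k, |f k (g x - g y)| * a k ≤ δ / 2 := by
      calc ∑ k, |f k (g x - g y)| * a k ≤ ∑ k, δ / (2 * (∑ k, a k + 1)) * a k := by
            refine Finset.sum_le_sum fun k _ => mul_le_mul_of_nonneg_right ?_ (ha k)
            rw [map_sub]
            exact hxy ⟨f k, hfc k⟩ (Finset.mem_image_of_mem _ (Finset.mem_univ k))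
        _ = δ / 2 * ((∑ k, a k) / (∑ k, a k + 1)) := by
            rw [← Finset.mul_sum]
            field_simp
        _ ≤ δ / 2 * 1 := by
            refine mul_le_mul_of_nonneg_left ?_ (by positivity)
            rw [div_le_one (by positivity)]
            linarith
        _ = δ / 2 := mul_one _
    have h2 : q (g x - g y) ≤ 2 * (|M| + 1) :=
      (map_sub_le_add q _ _).trans (by linarith [hM' x, hM' y])
    have h3 : δ / (4 * (|M| + 1)) * q (g x - g y) ≤ δ / 2 := by
      calc _ ≤ δ / (4 * (|M| + 1)) * (2 * (|M| + 1)) :=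
            mul_le_mul_of_nonneg_left h2 (by positivity)
        _ = δ / 2 := by
            field_simp
            norm_num
    linarith
  have sups : ∀ t : Finset P, ∀ δ : ℝ, 0 < δ → ∃ (s : Finset (E →L[ℝ] ℝ)) (η : ℝ), 0 < η ∧
      ∀ x y, (∀ f ∈ s, |f (g x) - f (g y)| ≤ η) →
        t.sup (fun i : P => (i : Seminorm ℝ E)) (g x - g y) ≤ δ := by
    intro t
    induction t using Finset.induction_on with
    | empty => exact fun δ hδ => ⟨∅, 1, one_pos, fun x y _ => by simpa using hδ.le⟩
    | insert i t _ ih =>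
      intro δ hδ
      obtain ⟨s₁, η₁, hη₁, h1⟩ := base i δ hδ
      obtain ⟨s₂, η₂, hη₂, h2⟩ := ih δ hδ
      refine ⟨s₁ ∪ s₂, min η₁ η₂, lt_min hη₁ hη₂, fun x y hxy => ?_⟩
      rw [Finset.sup_insert, Seminorm.sup_apply]
      exact sup_le
        (h1 x y fun f hf => (hxy f (Finset.mem_union_left _ hf)).trans (min_le_left _ _))
        (h2 x y fun f hf => (hxy f (Finset.mem_union_right _ hf)).trans (min_le_right _ _))
  obtain ⟨t, C, hC, hpC⟩ := Seminorm.bound_of_continuous hP p hp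
  have hC' : 0 < (C : ℝ) := by positivity
  obtain ⟨s, η, hη, h⟩ := sups t (δ / C) (by positivity)
  refine ⟨s, η, hη, fun x y hxy => (hpC _).trans ?_⟩
  change (C : ℝ) * _ ≤ δ
  rw [← le_div_iff₀' hC']
  exact h x y hxy

/-! ### Fréchet spaces -/

/-- A first countable locally convex space has a cofinal sequence of continuous seminorms. -/
theorem PolynormableSpace.exists_seq_seminorm (E : Type*) [AddCommGroup E] [Module ℝ E]
    [TopologicalSpace E] [PolynormableSpace ℝ E] [FirstCountableTopology E] :
    ∃ s : ℕ → {p : Seminorm ℝ E // Continuous p}, ∀ p : Seminorm ℝ E, Continuous p →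
      ∃ n, p ≤ (s n).1 := by
  have hE := PolynormableSpace.withSeminorms ℝ E
  have := hE.topologicalAddGroup
  have := hE.continuousSMul
  obtain ⟨U, hU⟩ := (𝓝 (0 : E)).exists_antitone_basis
  have hs : ∀ n, ∃ s : {p : Seminorm ℝ E // Continuous p}, s.1.ball 0 1 ⊆ U n := fun n => by
    obtain ⟨t, r, hr, ht⟩ := (hE.mem_nhds_iff 0 _).1 (hU.mem n)
    refine ⟨⟨(⟨r, hr.le⟩⁻¹ : ℝ≥0) • t.sup _,
      (Seminorm.continuous_finsetSup fun i _ => i.2).const_smul _⟩, fun x hx => ht ?_⟩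
    rw [Seminorm.mem_ball_zero] at hx ⊢
    change r⁻¹ * _ < 1 at hx
    rwa [inv_mul_lt_iff₀ hr, mul_one] at hx
  choose s hs using hs
  refine ⟨s, fun p hp => ?_⟩
  obtain ⟨n, -, hn⟩ := hU.1.mem_iff.1 (Seminorm.ball_mem_nhds hp one_pos)
  refine ⟨n, fun x => ?_⟩
  by_contra! hx
  have hpx : 0 < p x := (apply_nonneg _ _).trans_lt hx
  have hscale : ∀ r : Seminorm ℝ E, r ((p x)⁻¹ • x) = (p x)⁻¹ * r x := fun r => by
    rw [map_smul_eq_mul, Real.norm_eq_abs, abs_of_pos (inv_pos.2 hpx)]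
  have h1 : (p x)⁻¹ • x ∈ p.ball 0 1 := hn (hs n (by
    rw [Seminorm.mem_ball_zero, hscale, inv_mul_lt_iff₀ hpx, mul_one]
    exact hx))
  rw [Seminorm.mem_ball_zero, hscale, inv_mul_cancel₀ hpx.ne'] at h1
  exact lt_irrefl _ h1

/-- A complete space that embeds in a Hausdorff one has closed range. -/
theorem ContinuousLinearMap.isClosed_range_of_isFrechetSpace {E F : Type*} [AddCommGroup E]
    [Module ℝ E] [TopologicalSpace E] [IsTopologicalAddGroup E] [AddCommGroup F] [Module ℝ F]
    [TopologicalSpace F] [IsTopologicalAddGroup F] [T2Space F] (hE : IsFrechetSpace E)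
    (L : E →L[ℝ] F) (hL : IsInducing L) : IsClosed (Set.range L) := by
  let _ : UniformSpace E := IsTopologicalAddGroup.rightUniformSpace E
  let _ : UniformSpace F := IsTopologicalAddGroup.rightUniformSpace F
  have : IsUniformAddGroup E := isUniformAddGroup_of_addCommGroup
  have : IsUniformAddGroup F := isUniformAddGroup_of_addCommGroup
  have : CompleteSpace E := hE.complete
  exact (AddMonoidHom.isUniformInducing_of_isInducing hL).isComplete_range.isClosed

/-! ### Bounded predictable processes with values in a locally convex space -/

namespace BddPredictable

variable {Ω : Type*} {mΩ : MeasurableSpace Ω} {𝓕 : Filtration ℝ≥0 mΩ}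

section Basic

variable {Φ : Type*} [AddCommGroup Φ] [Module ℝ Φ] [TopologicalSpace Φ]

theorem ext {H G : BddPredictable 𝓕 Φ} (h : ∀ t ω, H t ω = G t ω) : H = G :=
  Subtype.ext <| funext fun t => funext fun ω => h t ω

theorem sum_apply {α : Type*} (s : Finset α) (H : α → BddPredictable 𝓕 Φ) (t : ℝ≥0) (ω : Ω) :
    (∑ i ∈ s, H i) t ω = ∑ i ∈ s, H i t ω :=
  map_sum ({ toFun := fun H => H t ω, map_zero' := rfl, map_add' := fun _ _ => rfl } :
    BddPredictable 𝓕 Φ →+ Φ) H s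

variable [IsTopologicalAddGroup Φ]

theorem le_supSeminorm (p : {p : Seminorm ℝ Φ // Continuous p}) (H : BddPredictable 𝓕 Φ)
    (t : ℝ≥0) (ω : Ω) : p.1 (H t ω) ≤ supSeminorm p H :=
  le_ciSup (bddAbove p.1 p.2 H) (t, ω)

theorem supSeminorm_le {p : {p : Seminorm ℝ Φ // Continuous p}} {H : BddPredictable 𝓕 Φ} {C : ℝ}
    (hC : 0 ≤ C) (h : ∀ t ω, p.1 (H t ω) ≤ C) : supSeminorm p H ≤ C :=
  Real.iSup_le (fun x => h x.1 x.2) hC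

theorem supSeminorm_mono {p q : {p : Seminorm ℝ Φ // Continuous p}} (h : p.1 ≤ q.1) :
    supSeminorm (𝓕 := 𝓕) p ≤ supSeminorm q := fun H =>
  supSeminorm_le (apply_nonneg _ _) fun t ω => (h _).trans (le_supSeminorm q H t ω)

/-- The seminorms `supSeminorm p` are cofinal among the continuous seminorms, not merely a
generating family. -/
theorem exists_le_supSeminorm (r : Seminorm ℝ (BddPredictable 𝓕 Φ)) (hr : Continuous r) :
    ∃ p : {p : Seminorm ℝ Φ // Continuous p}, r ≤ supSeminorm p := by
  obtain ⟨s, C, -, h⟩ := Seminorm.bound_of_continuous withSeminorms r hr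
  let q : {p : Seminorm ℝ Φ // Continuous p} :=
    ⟨s.sup Subtype.val, Seminorm.continuous_finsetSup fun i _ => i.2⟩
  refine ⟨⟨C • q.1, q.2.const_smul C⟩, fun H => (h H).trans ?_⟩
  change (C : ℝ) * s.sup (fun p => supSeminorm p) H ≤ _
  have h1 : s.sup (fun p => supSeminorm (𝓕 := 𝓕) p) ≤ supSeminorm q :=
    Finset.sup_le fun p hp => supSeminorm_mono (Finset.le_sup (f := Subtype.val) hp)
  refine (mul_le_mul_of_nonneg_left (h1 H) C.2).trans ?_
  change (C : ℝ) * (⨆ x : ℝ≥0 × Ω, q.1 (H x.1 x.2)) ≤ _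
  refine (Real.mul_iSup_of_nonneg C.2 _).le.trans ?_
  exact Real.iSup_le (fun x => le_supSeminorm ⟨C • q.1, q.2.const_smul C⟩ H x.1 x.2)
    (apply_nonneg _ _)

theorem map_injective {Ψ : Type*} [AddCommGroup Ψ] [Module ℝ Ψ] [TopologicalSpace Ψ]
    [IsTopologicalAddGroup Ψ] (T : Φ →L[ℝ] Ψ) (hT : Function.Injective T) :
    Function.Injective (map 𝓕 T) := fun _ _ h =>
  ext fun t ω => hT (congrArg (fun K : BddPredictable 𝓕 Ψ => K t ω) h)

theorem map_isEmbedding {Ψ : Type*} [AddCommGroup Ψ] [Module ℝ Ψ] [TopologicalSpace Ψ]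
    [IsTopologicalAddGroup Ψ] [PolynormableSpace ℝ Ψ] (T : Φ →L[ℝ] Ψ) (hT : IsEmbedding T) :
    IsEmbedding (map 𝓕 T) := by
  refine ⟨?_, map_injective T hT.injective⟩
  rw [IsTopologicalAddGroup.isInducing_iff_nhds_zero]
  refine le_antisymm ((map 𝓕 T).continuous.tendsto' 0 0 (map_zero _)).le_comap ?_
  have h0 := (SeminormFamily.withSeminorms_iff_nhds_eq_iInf _).1
    (withSeminorms (𝓕 := 𝓕) (Φ := Φ))
  rw [h0, le_iInf_iff]
  intro p
  obtain ⟨q, hq, hpq⟩ := Seminorm.exists_le_comp_of_isInducing p.2 (f := (T : Φ →ₗ[ℝ] Ψ))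
    hT.isInducing
  have hle : ∀ H : BddPredictable 𝓕 Φ, supSeminorm p H ≤ supSeminorm ⟨q, hq⟩ (map 𝓕 T H) :=
    fun H => supSeminorm_le (apply_nonneg _ _) fun t ω =>
      (hpq (H t ω)).trans (le_supSeminorm ⟨q, hq⟩ (map 𝓕 T H) t ω)
  rw [← Filter.tendsto_iff_comap]
  refine squeeze_zero (fun H => apply_nonneg _ _) hle ?_
  exact ((withSeminorms.continuous_seminorm (⟨q, hq⟩ : {p : Seminorm ℝ Ψ // Continuous p})).tendsto'
    0 0 (map_zero _)).comp Filter.tendsto_comap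

end Basic

/-! ### The space of processes with values in a Fréchet space -/

section Frechet

variable {Φ : Type*} [AddCommGroup Φ] [Module ℝ Φ] [TopologicalSpace Φ] [IsTopologicalAddGroup Φ]

theorem firstCountableTopology [PolynormableSpace ℝ Φ] [FirstCountableTopology Φ] :
    FirstCountableTopology (BddPredictable 𝓕 Φ) := by
  obtain ⟨s, hs⟩ := PolynormableSpace.exists_seq_seminorm Φ
  have h : WithSeminorms (fun n => supSeminorm (𝓕 := 𝓕) (s n)) := by
    refine withSeminorms.congr (fun n => ⟨{s n}, 1, ?_⟩) fun p => ?_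
    · rw [one_smul, Finset.sup_singleton]
      exact le_rfl
    · obtain ⟨n, hn⟩ := hs p.1 p.2
      refine ⟨{n}, 1, ?_⟩
      rw [one_smul, Finset.sup_singleton]
      exact supSeminorm_mono hn
  exact h.firstCountableTopology

theorem t1Space [PolynormableSpace ℝ Φ] [T1Space Φ] : T1Space (BddPredictable 𝓕 Φ) := by
  refine withSeminorms.T1_of_separating fun H hH => ?_
  obtain ⟨t, ω, h⟩ : ∃ t ω, H t ω ≠ 0 := by
    by_contra! h
    exact hH (ext h)
  obtain ⟨p, hp⟩ := (PolynormableSpace.withSeminorms ℝ Φ).separating_of_T1 _ h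
  refine ⟨p, fun h0 => hp (le_antisymm ?_ (apply_nonneg _ _))⟩
  exact (le_supSeminorm p H t ω).trans h0.le

open Filter in
/-- Cauchy sequences of processes converge uniformly to their pointwise limits. -/
theorem exists_tendsto_of_cauchySeq [PolynormableSpace ℝ Φ]
    (hΦ : @CompleteSpace Φ (IsTopologicalAddGroup.rightUniformSpace Φ))
    (G : ℕ → BddPredictable 𝓕 Φ)
    (hG : ∀ (p : {p : Seminorm ℝ Φ // Continuous p}) (ε : ℝ), 0 < ε →
      ∃ N, ∀ k ≥ N, ∀ l ≥ N, supSeminorm p (G k - G l) < ε) :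
    ∃ H, Tendsto G atTop (𝓝 H) := by
  let _ : UniformSpace Φ := IsTopologicalAddGroup.rightUniformSpace Φ
  have : IsUniformAddGroup Φ := isUniformAddGroup_of_addCommGroup
  have hsub : ∀ p : {p : Seminorm ℝ Φ // Continuous p}, ∀ k l t ω,
      p.1 (G k t ω - G l t ω) ≤ supSeminorm p (G k - G l) := fun p k l t ω =>
    le_supSeminorm p (G k - G l) t ω
  have hlim : ∀ t ω, ∃ y, Tendsto (fun k => G k t ω) atTop (𝓝 y) := fun t ω => by
    refine cauchySeq_tendsto_of_complete ?_
    rw [CauchySeq, IsUniformAddGroup.cauchy_map_iff_tendsto_swapped]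
    refine ⟨inferInstance, ?_⟩
    rw [(PolynormableSpace.withSeminorms ℝ Φ).tendsto_nhds]
    intro p ε hε
    obtain ⟨N, hN⟩ := hG p ε hε
    filter_upwards [(eventually_ge_atTop N).prod_mk (eventually_ge_atTop N)] with x hx
    rw [sub_zero]
    exact (hsub p _ _ t ω).trans_lt (hN _ hx.2 _ hx.1)
  choose H hH using hlim
  have hunif : ∀ (p : {p : Seminorm ℝ Φ // Continuous p}) (ε : ℝ), 0 < ε →
      ∃ N, ∀ k ≥ N, ∀ t ω, p.1 (G k t ω - H t ω) ≤ ε := fun p ε hε => by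
    obtain ⟨N, hN⟩ := hG p ε hε
    refine ⟨N, fun k hk t ω => ?_⟩
    refine le_of_tendsto ((p.2.tendsto _).comp (tendsto_const_nhds.sub (hH t ω))) ?_
    filter_upwards [eventually_ge_atTop N] with l hl
    exact ((hsub p k l t ω).trans_lt (hN k hk l hl)).le
  have hmem : H ∈ bddPredictableSubmodule 𝓕 Φ := fun f => by
    constructor
    · refine stronglyMeasurable_of_tendsto atTop (f := fun k => Function.uncurry fun t ω =>
        f (G k t ω)) (fun k => ((G k).2 f).1) ?_
      rw [tendsto_pi_nhds]
      exact fun x => (f.continuous.tendsto _).comp (hH x.1 x.2)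
    · obtain ⟨N, hN⟩ :=
        hunif ⟨(normSeminorm ℝ ℝ).comp f.toLinearMap, f.continuous.norm⟩ 1 one_pos
      obtain ⟨C, hC⟩ := ((G N).2 f).2
      refine ⟨C + 1, fun t ω => ?_⟩
      have h1 : |f (G N t ω - H t ω)| ≤ 1 := hN N le_rfl t ω
      rw [map_sub, abs_sub_comm] at h1
      linarith [abs_sub_abs_le_abs_sub (f (H t ω)) (f (G N t ω)), hC t ω]
  refine ⟨⟨H, hmem⟩, (withSeminorms.tendsto_nhds_atTop G _).2 fun p ε hε => ?_⟩
  obtain ⟨N, hN⟩ := hunif p (ε / 2) (half_pos hε)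
  exact ⟨N, fun k hk => (supSeminorm_le (half_pos hε).le (hN k hk)).trans_lt (half_lt_self hε)⟩

/-- The space `b𝒫(Φ)` is a Fréchet space if `Φ` is one. -/
theorem isFrechetSpace (hΦ : IsFrechetSpace Φ) : IsFrechetSpace (BddPredictable 𝓕 Φ) := by
  have := hΦ.continuousSMul
  have := hΦ.locallyConvex
  have := hΦ.metrizable
  have := firstCountableTopology (𝓕 := 𝓕) (Φ := Φ)
  have := t1Space (𝓕 := 𝓕) (Φ := Φ)
  let _ : UniformSpace (BddPredictable 𝓕 Φ) := IsTopologicalAddGroup.rightUniformSpace _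
  have : IsUniformAddGroup (BddPredictable 𝓕 Φ) := isUniformAddGroup_of_addCommGroup
  have hc : (uniformity (BddPredictable 𝓕 Φ)).IsCountablyGenerated :=
    IsUniformAddGroup.uniformity_countably_generated
  refine ⟨withSeminorms.continuousSMul, withSeminorms.toLocallyConvexSpace,
    UniformSpace.metrizableSpace, ?_⟩
  refine UniformSpace.complete_of_cauchySeq_tendsto fun G hG => ?_
  refine exists_tendsto_of_cauchySeq hΦ.complete G fun p ε hε => ?_
  rw [CauchySeq, IsUniformAddGroup.cauchy_map_iff_tendsto_swapped] at hG
  have h := (withSeminorms.tendsto_nhds _ _).1 hG.2 p ε hε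
  obtain ⟨⟨N, M⟩, hN⟩ :=
    Filter.eventually_atTop.1 (Filter.prod_atTop_atTop_eq (α := ℕ) (β := ℕ) ▸ h)
  refine ⟨max N M, fun k hk l hl => ?_⟩
  have := hN (l, k) ⟨(le_max_left _ _).trans hl, (le_max_right _ _).trans hk⟩
  rwa [sub_zero] at this

end Frechet

/-! ### Approximation by processes with finitely many values -/

section Simple

variable {Φ : Type*} [AddCommGroup Φ] [Module ℝ Φ] [TopologicalSpace Φ]

/-- The process with the value `v i` on the `i`-th set of a finite predictable partition, the
partition being given by its index function `c`. -/
def simple {m : ℕ} {c : ℝ≥0 × Ω → Fin m} (hc : Measurable[𝓕.predictable] c) (v : Fin m → Φ) :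
    BddPredictable 𝓕 Φ :=
  ⟨fun t ω => v (c (t, ω)), fun f => by
    refine ⟨?_, ∑ i, |f (v i)|, fun t ω => ?_⟩
    · have h : Measurable[𝓕.predictable] fun x => f (v (c x)) :=
        (measurable_of_countable fun i => f (v i)).comp hc
      exact h.stronglyMeasurable
    · exact Finset.single_le_sum (f := fun i => |f (v i)|) (fun _ _ => abs_nonneg _)
        (Finset.mem_univ _)⟩

/-- There is a finite predictable partition on whose sets finitely many given functionals of a
process oscillate little. -/
theorem exists_partition (H : BddPredictable 𝓕 Φ) (s : Finset (Φ →L[ℝ] ℝ)) {η : ℝ} (hη : 0 < η) :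
    ∃ (m : ℕ) (c : ℝ≥0 × Ω → Fin m), Measurable[𝓕.predictable] c ∧
      ∀ x y, c x = c y → ∀ f ∈ s, |f (H x.1 x.2) - f (H y.1 y.2)| ≤ η := by
  let _ : MeasurableSpace (ℝ≥0 × Ω) := 𝓕.predictable
  let b : ℝ≥0 × Ω → s → ℤ := fun x f => ⌊f.1 (H x.1 x.2) / η⌋
  have hb : Measurable b := measurable_pi_iff.2 fun f =>
    (((H.2 f.1).1.measurable).div_const η).floor
  have hfin : (Set.range b).Finite := by
    choose C hC using fun f : s => (H.2 f.1).2
    refine (Set.Finite.pi' fun f : s => Set.finite_Icc ⌊-C f / η⌋ ⌊C f / η⌋).subset ?_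
    rintro _ ⟨x, rfl⟩ f
    have h := abs_le.1 (hC f x.1 x.2)
    exact ⟨Int.floor_le_floor (div_le_div_of_nonneg_right h.1 hη.le),
      Int.floor_le_floor (div_le_div_of_nonneg_right h.2 hη.le)⟩
  have := hfin.to_subtype
  obtain ⟨m, ⟨e⟩⟩ := Finite.exists_equiv_fin (Set.range b)
  refine ⟨m, fun x => e ⟨b x, x, rfl⟩, ?_, fun x y hxy f hf => ?_⟩
  · refine measurable_to_countable' fun i => ?_
    convert hb (measurableSet_singleton (e.symm i).1)
    ext x
    simp [← Equiv.eq_symm_apply, Subtype.ext_iff]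
  · have h1 : b x = b y := congrArg Subtype.val (e.injective hxy)
    have h2 := Int.abs_sub_lt_one_of_floor_eq_floor (congrFun h1 ⟨f, hf⟩)
    rw [← sub_div, abs_div, abs_of_pos hη, div_lt_one hη] at h2
    exact h2.le

/-- Processes with values in a nuclear space are uniform limits of processes with finitely many
values. The approximants take (apart from `0`) only values of the given process. -/
theorem exists_simple_approx [IsTopologicalAddGroup Φ] (hΦ : IsNuclearSpace Φ)
    (G : BddPredictable 𝓕 Φ) (p : {p : Seminorm ℝ Φ // Continuous p}) {δ : ℝ} (hδ : 0 < δ) :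
    ∃ (m : ℕ) (c : ℝ≥0 × Ω → Fin m) (hc : Measurable[𝓕.predictable] c) (v : Fin m → Φ),
      (∀ i, v i = 0 ∨ ∃ t ω, v i = G t ω) ∧ supSeminorm p (G - simple hc v) ≤ δ := by
  classical
  obtain ⟨s, η, hη, hs⟩ := hΦ.exists_finset_dual (fun x : ℝ≥0 × Ω => G x.1 x.2)
    (fun q hq => bddAbove q hq G) p.1 p.2 hδ
  obtain ⟨m, c, hc, hcs⟩ := exists_partition G s hη
  have hv : ∀ i, ∃ v, (v = 0 ∨ ∃ t ω, v = G t ω) ∧ ∀ x, c x = i → p.1 (G x.1 x.2 - v) ≤ δ := by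
    intro i
    by_cases hi : ∃ y, c y = i
    · obtain ⟨y, rfl⟩ := hi
      exact ⟨G y.1 y.2, .inr ⟨y.1, y.2, rfl⟩, fun x hx => hs x y (hcs x y hx)⟩
    · exact ⟨0, .inl rfl, fun x hx => (hi ⟨x, hx⟩).elim⟩
  choose v hv1 hv2 using hv
  exact ⟨m, c, hc, v, hv1, supSeminorm_le hδ.le fun t ω => hv2 _ (t, ω) rfl⟩

end Simple

/-! ### Processes with values in a strict inductive limit -/

section Limit

variable {E : ℕ → Type*} [∀ n, AddCommGroup (E n)] [∀ n, Module ℝ (E n)]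
  [∀ n, TopologicalSpace (E n)] [∀ n, IsTopologicalAddGroup (E n)]
  {F : Type*} [AddCommGroup F] [Module ℝ F] [TopologicalSpace F] [IsTopologicalAddGroup F]
  {ι : ∀ n, E n →L[ℝ] E (n + 1)} {j : ∀ n, E n →L[ℝ] F}

/-- Every process with values in a strict inductive limit comes from a process with values in one of
the steps. -/
theorem exists_map_eq [∀ n, PolynormableSpace ℝ (E n)]
    (h : IsStrictInductiveLimit ι j) (hcl : ∀ n, IsClosed (Set.range (ι n)))
    (H : BddPredictable 𝓕 F) : ∃ n, ∃ G : BddPredictable 𝓕 (E n), map 𝓕 (j n) G = H := by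
  obtain ⟨n, hn⟩ := h.exists_forall_mem_range hcl (fun x : ℝ≥0 × Ω => H x.1 x.2)
    fun q hq => bddAbove q hq H
  choose G hG using fun t ω => hn (t, ω)
  refine ⟨n, ⟨G, fun f => ?_⟩, ext hG⟩
  obtain ⟨g, hg⟩ := h.exists_dual_extension hcl n f
  have hfg : (fun t ω => f (G t ω)) = fun t ω => g (H t ω) := by
    funext t ω
    rw [← hg, hG]
  rw [hfg]
  exact H.2 g

/-- A seminorm on `b𝒫(F)` whose restrictions to the spaces `b𝒫(E n)` are continuous is continuous.
If its restrictions are bounded by `sup (p n)`, then it is bounded by twice the supremum of the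
seminorm `q y = inf {∑ n, 2 ^ n * p n (x n) | y = ∑ n, j n (x n)}`. Indeed, up to a small error
a process `H` has finitely many values; a decomposition of each of these values that is nearly
optimal for `q` yields a decomposition of `H` into processes with values in the `E n`. -/
theorem exists_le_two_mul_supSeminorm [∀ n, PolynormableSpace ℝ (E n)]
    (h : IsStrictInductiveLimit ι j) (hcl : ∀ n, IsClosed (Set.range (ι n)))
    (hnuc : ∀ n, IsNuclearSpace (E n)) (r : Seminorm ℝ (BddPredictable 𝓕 F))
    (hr : ∀ n, Continuous fun G => r (map 𝓕 (j n) G)) :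
    ∃ q : {q : Seminorm ℝ F // Continuous q}, ∀ H, r H ≤ 2 * supSeminorm q H := by
  classical
  choose p hp using fun n => exists_le_supSeminorm
    (r.comp (map 𝓕 (j n)).toLinearMap) (hr n)
  have hp : ∀ n G, r (map 𝓕 (j n) G) ≤ supSeminorm (p n) G := hp
  let σ : (Π₀ n, E n) →ₗ[ℝ] F := DFinsupp.lsum ℝ fun n => (j n : E n →ₗ[ℝ] F)
  have hσs : ∀ n x, σ (DFinsupp.single n x) = j n x := fun n x => by simp [σ]
  have hσ : Function.Surjective σ := fun y => by
    obtain ⟨n, x, rfl⟩ := h.exists_preimage y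
    exact ⟨_, hσs n x⟩
  have hσsum : ∀ x (T : Finset ℕ), x.support ⊆ T → σ x = ∑ n ∈ T, j n (x n) := fun x T hT => by
    have h1 : σ x = ∑ n ∈ x.support, j n (x n) := by
      simp [σ, DFinsupp.lsum_apply_apply, DFinsupp.sumAddHom_apply, DFinsupp.sum]
    rw [h1]
    exact Finset.sum_subset hT fun n _ hn => by rw [DFinsupp.notMem_support_iff.1 hn, map_zero]
  let P : Seminorm ℝ (Π₀ n, E n) := Seminorm.directSum fun n => (2 ^ n : ℝ≥0) • (p n).1
  have hP : ∀ n x, (p n).1 (x n) ≤ (1 / 2) ^ n * P x := fun n x => by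
    have h1 : (2 : ℝ) ^ n * (p n).1 (x n) ≤ P x := by
      have := Seminorm.le_directSum (fun n => (2 ^ n : ℝ≥0) • (p n).1) x n
      change ((2 ^ n : ℝ≥0) : ℝ) * (p n).1 (x n) ≤ _ at this
      simpa using this
    rw [one_div, inv_pow, ← div_eq_inv_mul, le_div_iff₀' (by positivity)]
    exact h1
  let q : Seminorm ℝ F := Seminorm.pushforward σ hσ P
  have hq : Continuous q := h.continuous_seminorm q fun n => by
    refine Seminorm.continuous_of_le (q := (2 ^ n : ℝ≥0) • (p n).1)
      ((p n).2.const_smul (2 ^ n : ℝ≥0)) fun x => ?_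
    change q (j n x) ≤ _
    rw [← hσs]
    exact (Seminorm.pushforward_apply_le _).trans (Seminorm.directSum_single _ n x)
  refine ⟨⟨q, hq⟩, fun H => ?_⟩
  obtain ⟨N, G, hGH⟩ := exists_map_eq h hcl H
  have hM : ∀ t ω, q (H t ω) ≤ supSeminorm ⟨q, hq⟩ H := le_supSeminorm ⟨q, hq⟩ H
  have hM0 : 0 ≤ supSeminorm ⟨q, hq⟩ H := apply_nonneg _ _
  set M := supSeminorm ⟨q, hq⟩ H
  refine le_of_forall_pos_le_add fun ε hε => ?_
  obtain ⟨m, c, hc, v, hv, hGv⟩ := exists_simple_approx (hnuc N) G (p N)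
    (δ := ε / 3) (by positivity)
  have hu : ∀ i, ∃ u, σ u = j N (v i) ∧ P u < M + ε / 3 := fun i => by
    refine Seminorm.exists_lt_of_pushforward_lt (hσ := hσ) ?_
    obtain h0 | ⟨t, ω, h0⟩ := hv i
    · rw [h0, map_zero, map_zero]
      positivity
    · have : j N (G t ω) = H t ω := by
        rw [← hGH]
        rfl
      rw [h0, this]
      linarith [hM t ω]
  choose u hu1 hu2 using hu
  let T : Finset ℕ := Finset.univ.biUnion fun i => (u i).support
  have hdec : map 𝓕 (j N) (simple hc v) =
      ∑ n ∈ T, map 𝓕 (j n) (simple hc fun i => u i n) := by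
    refine ext fun t ω => ?_
    rw [sum_apply]
    change j N (v (c (t, ω))) = ∑ n ∈ T, j n (u (c (t, ω)) n)
    rw [← hu1, hσsum _ T
      (Finset.subset_biUnion_of_mem (fun i => (u i).support) (Finset.mem_univ _))]
  have hsimple : r (map 𝓕 (j N) (simple hc v)) ≤ 2 * (M + ε / 3) := by
    have hM' : 0 ≤ M + ε / 3 := by positivity
    rw [hdec]
    calc r (∑ n ∈ T, map 𝓕 (j n) (simple hc fun i => u i n))
        ≤ ∑ n ∈ T, r (map 𝓕 (j n) (simple hc fun i => u i n)) :=
          Finset.le_sum_of_subadditive r (map_zero r).le (map_add_le_add r) _ _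
      _ ≤ ∑ n ∈ T, (1 / 2) ^ n * (M + ε / 3) := Finset.sum_le_sum fun n _ =>
          (hp n _).trans <| supSeminorm_le (by positivity) fun t ω =>
            (hP n _).trans (mul_le_mul_of_nonneg_left (hu2 _).le (by positivity))
      _ = (∑ n ∈ T, (1 / 2) ^ n) * (M + ε / 3) := (Finset.sum_mul _ _ _).symm
      _ ≤ 2 * (M + ε / 3) := by
          refine mul_le_mul_of_nonneg_right ?_ hM'
          exact (summable_geometric_two.sum_le_tsum T fun n _ => by positivity).trans_eq
            tsum_geometric_two
  have hrest := (hp N (G - simple hc v)).trans hGv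
  have hadd := map_add_le_add r (map 𝓕 (j N) (G - simple hc v)) (map 𝓕 (j N) (simple hc v))
  rw [← map_add, sub_add_cancel, hGH] at hadd
  linarith

end Limit

end BddPredictable

/-- A vector space topology is finer than a locally convex one if it makes all seminorms that are
continuous for the latter continuous. -/
theorem TopologicalSpace.le_of_forall_seminorm {E : Type*} [AddCommGroup E] [Module ℝ E]
    {τ t : TopologicalSpace E} (hτ : @IsTopologicalAddGroup E τ _)
    (h1 : @IsTopologicalAddGroup E t _) (h2 : @ContinuousSMul ℝ E _ _ t)
    (h3 : @LocallyConvexSpace ℝ E _ _ _ _ t)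
    (h : ∀ r : Seminorm ℝ E, Continuous[t, _] r → Continuous[τ, _] r) : τ ≤ t := by
  have hP : @PolynormableSpace ℝ E _ _ _ t := LocallyConvexSpace.toPolynormableSpace
  have hW := @PolynormableSpace.withSeminorms ℝ E _ _ _ t hP
  rw [← continuous_id_iff_le]
  exact @WithSeminorms.continuous_of_continuous_comp ℝ ℝ E E _ _ _ _ _ _ _ (RingHom.id ℝ) _ _
    τ hτ t hW LinearMap.id fun r => h r.1 r.2

theorem mainTheorem11 {Ω : Type*} {mΩ : MeasurableSpace Ω} (𝓕 : Filtration ℝ≥0 mΩ)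
    {Φn : ℕ → Type*} [∀ n, AddCommGroup (Φn n)] [∀ n, Module ℝ (Φn n)]
    [∀ n, TopologicalSpace (Φn n)] [∀ n, IsTopologicalAddGroup (Φn n)]
    {Φ : Type*} [AddCommGroup Φ] [Module ℝ Φ] [TopologicalSpace Φ] [IsTopologicalAddGroup Φ]
    (ι : ∀ n, Φn n →L[ℝ] Φn (n + 1)) (j : ∀ n, Φn n →L[ℝ] Φ)
    (hFrechet : ∀ n, IsFrechetSpace (Φn n)) (hNuclear : ∀ n, IsNuclearSpace (Φn n))
    (hlim : IsStrictInductiveLimit ι j) :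
    (∀ n, IsFrechetSpace (BddPredictable 𝓕 (Φn n))) ∧
      IsStrictInductiveLimit (fun n => BddPredictable.map 𝓕 (ι n))
        (fun n => BddPredictable.map 𝓕 (j n)) := by
  have := fun n => (hFrechet n).continuousSMul
  have := fun n => (hFrechet n).locallyConvex
  have := fun n => (hNuclear n).t2
  have hcl : ∀ n, IsClosed (Set.range (ι n)) := fun n =>
    (ι n).isClosed_range_of_isFrechetSpace (hFrechet n) (hlim.isEmbedding n).isInducing
  refine ⟨fun n => BddPredictable.isFrechetSpace (hFrechet n), ?_⟩
  refine ⟨fun n => BddPredictable.map_isEmbedding (ι n) (hlim.isEmbedding n),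
    fun n => BddPredictable.map_injective (j n) (hlim.injective n),
    fun n H => BddPredictable.ext fun t ω => hlim.compat n (H t ω),
    BddPredictable.exists_map_eq hlim hcl, ?_⟩
  have hW := BddPredictable.withSeminorms (𝓕 := 𝓕) (Φ := Φ)
  refine ⟨⟨inferInstance, hW.continuousSMul, hW.toLocallyConvexSpace,
    fun n => (BddPredictable.map 𝓕 (j n)).continuous⟩, ?_⟩
  have key := BddPredictable.exists_le_two_mul_supSeminorm (𝓕 := 𝓕) hlim hcl hNuclear
  have hcont : ∀ r : Seminorm ℝ (BddPredictable 𝓕 Φ),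
      (∀ n, Continuous fun G => r (BddPredictable.map 𝓕 (j n) G)) → Continuous r := fun r hr => by
    obtain ⟨q, hq⟩ := key r hr
    have hle : r ≤ (2 : ℝ≥0) • BddPredictable.supSeminorm q := hq
    exact Seminorm.continuous_of_le ((hW.continuous_seminorm q).const_smul (2 : ℝ≥0)) hle
  rintro t ⟨h1, h2, h3, h4⟩
  refine TopologicalSpace.le_of_forall_seminorm inferInstance h1 h2 h3
    fun r hr => hcont r fun n => hr.comp (h4 n)
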